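/- Consider lattice paths in $\mathbb Z^2$ with steps $N=(0,1)$ and $E=(1,0)$. The vertices of a path are numbered $0,1,2,\dots$ from its start; a valley is a vertex preceded by an $E$ and followed by an $N$, and $\mathrm{maj}(P)$ is the sum of the positions of the valleys of $P$. A crossing of two paths $P,Q$ is a common vertex $C$ such that $P$ and $Q$ disagree in the step arriving at $C$, they disagree again in some step after $C$, and at the first step after $C$ where they disagree again each path has the same type of step ($N$ or $E$) as it had when arriving at $C$. For $r\ge 0$ and points $A,B,A',B'\in\mathbb Z^2$ let $$H^{\ge r}_{A\to B,\,A'\to B'}(q)=\sum_{(P,Q)} q^{\mathrm{maj}(P)+\mathrm{maj}(Q)},$$ summed over all pairs of a path $P$ from $A$ to $B$ and a path $Q$ from $A'$ to $B'$ having at least $r$ crossings. Let $\binom{n}{k}_q=\frac{(1-q^n)(1-q^{n-1})\cdots(1-q^{n-k+1})}{(1-q^k)(1-q^{k-1})\cdots(1-q)}$ if $0\le k\le n$, and $\binom nk_q=0$ otherwise. For any points $A_1=(x_1,y_1)$, $A_2=(x_2,y_2)$, $D_1=(u_1,v_1)$, $D_2=(u_2,v_2)$ of $\mathbb Z^2$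 put $$f_{r,A_1,A_2,D_2,D_1}(q)=q^{r(r+x_2-x_1)}\binom{u_2-x_1+v_2-y_1}{u_2-x_1+r}_q\binom{u_1-x_2+v_1-y_2}{u_1-x_2-r}_q .$$ Write $A_1\prec A_2$ if $x_1<x_2$ and $y_1>y_2$. Theorem. Let $A_1=(x_1,y_1)$, $A_2=(x_2,y_2)$, $B_1$, $B_2$ be points in $\mathbb Z^2$ with $A_1\prec A_2$, $B_1\prec B_2$ and $x_1+y_1=x_2+y_2$. Then, for all $m\ge0$, $$H^{\ge 2m+1}_{A_1\to B_2,\,A_2\to B_1}(q)=H^{\ge 2m}_{A_1\to B_2,\,A_2\to B_1}(q)=f_{2m,A_1,A_2,B_2,B_1}(q),$$ and for all $m\ge1$, $$H^{\ge 2m}_{A_1\to B_1,\,A_2\to B_2}(q)=H^{\ge 2m-1}_{A_1\to B_1,\,A_2\to B_2}(q)=f_{2m-1,A_1,A_2,B_2,B_1}(q).$$ Moreover, for all points $A,B\in\mathbb Z^2$ and all $r\ge0$, $$H^{\ge r}_{A\to B_1,\,A\to B_2}(q)=f_{r,A,A,B_2,B_1}(q),\qquad H^{\ge r}_{A_1\to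 B,\,A_2\to B}(q)=f_{r,A_1,A_2,B,B}(q),$$ $$H^{\ge r}_{A\to B,\,A\to B}(q)=\begin{cases} f_{0,A,A,B,B}(q) & \text{if } r=0,\\ 2\sum_{j\ge1}(-1)^{j-1}f_{r+j,A,A,B,B}(q) & \text{if } r\ge1,\end{cases}$$ where the last sum has only finitely many nonzero terms. -/

import Mathlib

open Polynomial

noncomputable section

namespace NEPath

/-- The two kinds of steps of a lattice path: north and east. -/
inductive Step where
  | N : Step
  | E : Step
deriving DecidableEq

instance : Fintype Step where
  elems := {.N, .E}
  complete := by rintro (_ | _) <;> simp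

/-- The displacement vector of a step: `N = (0, 1)` and `E = (1, 0)`. -/
def Step.vec : Step → ℤ × ℤ
  | .N => (0, 1)
  | .E => (1, 0)

/-- The point reached from `A` by following the steps of the word `w`. -/
def endPoint (A : ℤ × ℤ) (w : List Step) : ℤ × ℤ := A + (w.map Step.vec).sum

theorem length_eq_of_endPoint {A B : ℤ × ℤ} {w : List Step} (h : endPoint A w = B) :
    w.length = (B.1 - A.1 + (B.2 - A.2)).toNat := by
  have key : ∀ l : List Step,
      (l.map Step.vec).sum.1 + (l.map Step.vec).sum.2 = (l.length : ℤ) := by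
    intro l
    induction l with
    | nil => simp
    | cons s l ih =>
      cases s <;> simp [Step.vec] <;> linarith
  have := key w
  subst h
  simp only [endPoint, Prod.fst_add, Prod.snd_add]
  omega

/-- The lattice paths from `A` to `B` with steps `N` and `E`, as step sequences. -/
abbrev LPath (A B : ℤ × ℤ) : Type := {w : List Step // endPoint A w = B}

instance (A B : ℤ × ℤ) : Finite (LPath A B) :=
  Set.Finite.subset (List.finite_length_eq Step _) (fun _ h => length_eq_of_endPoint h)

instance (A B : ℤ × ℤ) : Fintype (LPath A B) := Fintype.ofFinite _

/-- The major index: the sum of the positions of the valleys, that is, of the vertices preceded by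
an `E` and followed by an `N`; the vertex between the steps `w[i]` and `w[i+1]` has
position `i + 1`. -/
def maj (w : List Step) : ℕ :=
  ∑ i ∈ (Finset.range w.length).filter (fun i => w[i]? = some .E ∧ w[i + 1]? = some .N), (i + 1)

/-- `C` is a crossing of the path `P` starting at `A` and the path `Q` starting at `A'`: both paths
visit `C`, they arrive at `C` with different steps `s ≠ t`, then agree along some (possibly empty)
common word `W`, and at the first step after `C` where they disagree again each one takes the same
type of step as it had when arriving at `C`. -/
def IsCrossing (A : ℤ × ℤ) (P : List Step) (A' : ℤ × ℤ) (Q : List Step) (C : ℤ × ℤ) : Prop :=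
  ∃ (P₁ P₂ Q₁ Q₂ W : List Step) (s t : Step), s ≠ t ∧
    P = (P₁ ++ [s]) ++ (W ++ [s] ++ P₂) ∧ Q = (Q₁ ++ [t]) ++ (W ++ [t] ++ Q₂) ∧
    endPoint A (P₁ ++ [s]) = C ∧ endPoint A' (Q₁ ++ [t]) = C

/-- The number of crossings of two paths. -/
def cro (A : ℤ × ℤ) (P : List Step) (A' : ℤ × ℤ) (Q : List Step) : ℕ :=
  {C : ℤ × ℤ | IsCrossing A P A' Q C}.ncard

open Classical in
/-- The pairs of paths `P` from `A` to `B` and `Q` from `A'` to `B'` with at least `r` crossings. -/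
def pairs (r : ℕ) (A B A' B' : ℤ × ℤ) : Finset (LPath A B × LPath A' B') :=
  Finset.univ.filter (fun p => r ≤ cro A p.1.1 A' p.2.1)

/-- The generating polynomial of the pairs of paths from `A` to `B` and from `A'` to `B'` with at
least `r` crossings with respect to the total major index. -/
def H (r : ℕ) (A B A' B' : ℤ × ℤ) : ℚ[X] :=
  ∑ p ∈ pairs r A B A' B', X ^ (maj p.1.1 + maj p.2.1)

/-- The `q`-binomial coefficient (with `q = RatFunc.X`): the product of the `1 - q ^ (n - i)`
divided by the product of the `1 - q ^ (k - i)`, for `0 ≤ i < k`, if `0 ≤ k ≤ n`,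
and `0` otherwise. -/
def qbinom (n k : ℤ) : RatFunc ℚ :=
  if 0 ≤ k ∧ k ≤ n then
    (∏ i ∈ Finset.range k.toNat, (1 - RatFunc.X ^ (n.toNat - i))) /
      (∏ i ∈ Finset.range k.toNat, (1 - RatFunc.X ^ (k.toNat - i)))
  else 0

/-- `f r A₁ A₂ B B'` with `A₁ = (x₁, y₁)`, `A₂ = (x₂, y₂)`, `B = (u, v)`, `B' = (u', v')` is
`q ^ (r (r + x₂ - x₁)) [u - x₁ + v - y₁; u - x₁ + r]_q [u' - x₂ + v' - y₂; u' - x₂ - r]_q`. -/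
def f (r : ℕ) (A₁ A₂ B B' : ℤ × ℤ) : RatFunc ℚ :=
  RatFunc.X ^ ((r : ℤ) * (r + A₂.1 - A₁.1)) *
    qbinom (B.1 - A₁.1 + B.2 - A₁.2) (B.1 - A₁.1 + r) *
    qbinom (B'.1 - A₂.1 + B'.2 - A₂.2) (B'.1 - A₂.1 - r)

/-- `A` is strictly northwest of `B`. -/
def StrictNW (A B : ℤ × ℤ) : Prop := A.1 < B.1 ∧ B.2 < A.2

end NEPath

end

/-!
Both paths start on one antidiagonal, so after equally many steps they are on a common antidiagonal
again, and a crossing is a change of sign of the difference of their abscissas. The proof appends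
a step to each of the two paths at a time.

The major index is handled by two weights of a path `P`, namely `q ^ maj P` and `q ^ maj (P N)`.
The corresponding generating functions of paths with `n` steps, `k` of them east, are `[n; k]` and
`q ^ k [n; k]` (`gauss`), by the two `q`-Pascal recurrences, and pairs of paths without a condition
on crossings have the product of two such factors (`pairGF_of_forall`).

To control the crossings, count those that a pair of paths will have if the first path `P`
continues to the east of the second path `Q` (`eastCro`). While `P` is weakly to the east of `Q`
this number does not change. Hence the pairs with at least `k` crossings seen from the east satisfy
the recurrence of the unrestricted pairs, except that pairs that meet coming from the west have to be
taken from the pairs with at least `k - 1` crossings seen from the other side. At this boundary the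
product for the other side consists of the same two `q`-binomial coefficients in exchanged order, and
the powers of `q` match because exactly the path that is about to step north carries the weight
`q ^ maj (P N)` (`shiftedGF_reflect`). So the products follow by induction on `k` (`eastGF_succ`,
`eastGF_self`, `eastGF_of_lt`), starting from the case where all pairs are counted.

When the paths end at different points of one antidiagonal, `eastCro` is the number of crossings,
and the part of a longer path after the end of the other one is free (`H_eq_shiftedF`). When they
end at the same point, the crossings seen from the two sides are the number of crossings and one
more. If the starting points differ, the parity tells which is which (`H_of_common_end`); if they
agree, adding up the two sides gives a recurrence in the number of crossings (`H_add_H_succ`),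
which an alternating sum solves (`eq_two_mul_finsum`).
-/

namespace NEPath

/-! ### Crossings under appending steps -/

theorem endPoint_append (A : ℤ × ℤ) (v w : List Step) :
    endPoint A (v ++ w) = endPoint A v + (w.map Step.vec).sum := by
  simp [endPoint, add_assoc]

theorem endPoint_concat (A : ℤ × ℤ) (w : List Step) (s : Step) :
    endPoint A (w ++ [s]) = endPoint A w + s.vec := by
  simp [endPoint_append]

theorem endPoint_fst_add_snd (A : ℤ × ℤ) (w : List Step) :
    (endPoint A w).1 + (endPoint A w).2 = A.1 + A.2 + w.length := by
  induction w using List.reverseRecOn with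
  | nil => simp [endPoint]
  | append_singleton w s ih =>
    rw [endPoint_concat]
    cases s <;> simp [Step.vec] <;> linarith

/-- Simultaneous induction on two words of equal length, appending a step to each of them. -/
theorem snoc_induction₂ {p : List Step → List Step → Prop} (nil : p [] [])
    (snoc : ∀ (P Q : List Step) (a b : Step), P.length = Q.length → p P Q →
      p (P ++ [a]) (Q ++ [b])) (P Q : List Step) (h : P.length = Q.length) : p P Q := by
  induction P using List.reverseRecOn generalizing Q with
  | nil =>
    have : Q = [] := List.length_eq_zero_iff.mp (by simpa using h.symm)
    exact this ▸ nil
  | append_singleton P a ih =>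
    rcases List.eq_nil_or_concat' Q with rfl | ⟨Q, b, rfl⟩
    · simp at h
    · have h' : P.length = Q.length := by simpa using h
      exact snoc P Q a b h' (ih Q h')

/-- `LastDis s t P Q`: at the last step, counted from the end, where `P` and `Q` disagree,
`P` takes the step `s` and `Q` takes the step `t` (meaningful when `s ≠ t`). -/
def LastDis (s t : Step) (P Q : List Step) : Prop :=
  ∃ P₁ Q₁ W : List Step, P = P₁ ++ [s] ++ W ∧ Q = Q₁ ++ [t] ++ W

theorem LastDis.symm {s t : Step} {P Q : List Step} (h : LastDis s t P Q) : LastDis t s Q P := by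
  obtain ⟨P₁, Q₁, W, h₁, h₂⟩ := h
  exact ⟨Q₁, P₁, W, h₂, h₁⟩

theorem not_lastDis_nil (s t : Step) : ¬ LastDis s t [] [] := by
  rintro ⟨P₁, Q₁, W, h₁, -⟩
  simp at h₁

theorem lastDis_concat_iff {s t : Step} {P Q : List Step} {a b : Step} :
    LastDis s t (P ++ [a]) (Q ++ [b]) ↔ (a = s ∧ b = t) ∨ (a = b ∧ LastDis s t P Q) := by
  constructor
  · rintro ⟨P₁, Q₁, W, h₁, h₂⟩
    rcases List.eq_nil_or_concat' W with rfl | ⟨W, x, rfl⟩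
    · simp only [List.append_nil] at h₁ h₂
      exact Or.inl ⟨by simpa using (List.append_inj' h₁ rfl).2,
        by simpa using (List.append_inj' h₂ rfl).2⟩
    · rw [← List.append_assoc] at h₁ h₂
      have e₁ := List.append_inj' h₁ rfl
      have e₂ := List.append_inj' h₂ rfl
      refine Or.inr ⟨?_, P₁, Q₁, W, e₁.1, e₂.1⟩
      have := e₁.2; have := e₂.2
      simp_all
  · rintro (⟨rfl, rfl⟩ | ⟨rfl, P₁, Q₁, W, rfl, rfl⟩)
    · exact ⟨P, Q, [], by simp, by simp⟩
    · exact ⟨P₁, Q₁, W ++ [a], by simp, by simp⟩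

/-- The common tail after the last disagreement is unique. -/
theorem commonTail_unique {a b : Step} (hab : a ≠ b) {W W' P₁ P₁' Q₁ Q₁' : List Step}
    (hP : P₁ ++ [a] ++ W = P₁' ++ [a] ++ W') (hQ : Q₁ ++ [b] ++ W = Q₁' ++ [b] ++ W') :
    W = W' := by
  induction W using List.reverseRecOn generalizing W' with
  | nil =>
    rcases List.eq_nil_or_concat' W' with rfl | ⟨W', x, rfl⟩
    · rfl
    · rw [← List.append_assoc, List.append_nil] at hP hQ
      have e₁ := (List.append_inj' hP rfl).2
      have e₂ := (List.append_inj' hQ rfl).2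
      simp_all
  | append_singleton W y ih =>
    rcases List.eq_nil_or_concat' W' with rfl | ⟨W', x, rfl⟩
    · rw [← List.append_assoc, List.append_nil] at hP hQ
      have e₁ := (List.append_inj' hP rfl).2
      have e₂ := (List.append_inj' hQ rfl).2
      simp_all
    · rw [← List.append_assoc, ← List.append_assoc] at hP hQ
      have e₁ := List.append_inj' hP rfl
      have e₂ := List.append_inj' hQ rfl
      rw [ih e₁.1 e₂.1, (by simpa using e₁.2 : y = x)]

theorem isCrossing_comm {A A' C : ℤ × ℤ} {P Q : List Step} :
    IsCrossing A P A' Q C ↔ IsCrossing A' Q A P C := by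
  constructor <;> rintro ⟨P₁, P₂, Q₁, Q₂, W, s, t, h, h₁, h₂, h₃, h₄⟩ <;>
    exact ⟨Q₁, Q₂, P₁, P₂, W, t, s, h.symm, h₂, h₁, h₄, h₃⟩

theorem cro_comm (A A' : ℤ × ℤ) (P Q : List Step) : cro A P A' Q = cro A' Q A P := by
  simp only [cro, isCrossing_comm (A := A)]

theorem finite_isCrossing (A A' : ℤ × ℤ) (P Q : List Step) :
    {C | IsCrossing A P A' Q C}.Finite := by
  refine ((Set.finite_Iic P.length).image (fun i => endPoint A (P.take i))).subset ?_
  rintro C ⟨P₁, P₂, Q₁, Q₂, W, s, t, -, h₁, -, h₃, -⟩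
  refine ⟨(P₁ ++ [s]).length, ?_, ?_⟩
  · rw [h₁]; simp
  · simp only [h₁, List.take_left]
    exact h₃

/-- Paths that start on the same antidiagonal visit a common point at the same time. -/
theorem length_eq_of_endPoint_eq {A A' C : ℤ × ℤ} (hA : A.1 + A.2 = A'.1 + A'.2)
    {P Q : List Step} (hP : endPoint A P = C) (hQ : endPoint A' Q = C) :
    P.length = Q.length := by
  have h₁ := endPoint_fst_add_snd A P
  have h₂ := endPoint_fst_add_snd A' Q
  rw [hP] at h₁
  rw [hQ] at h₂
  omega

theorem endPoint_eq_iff {A A' : ℤ × ℤ} (hA : A.1 + A.2 = A'.1 + A'.2)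
    {P Q : List Step} (h : P.length = Q.length) :
    endPoint A P = endPoint A' Q ↔ (endPoint A P).1 = (endPoint A' Q).1 := by
  have h₁ := endPoint_fst_add_snd A P
  have h₂ := endPoint_fst_add_snd A' Q
  rw [Prod.ext_iff]
  omega

/-- A crossing of the extended words that is not one of `P` and `Q` has its second disagreement in
the last steps. -/
theorem isCrossing_concat_iff {A A' C : ℤ × ℤ} (hA : A.1 + A.2 = A'.1 + A'.2)
    {P Q : List Step} (h : P.length = Q.length) {a b : Step} :
    IsCrossing A (P ++ [a]) A' (Q ++ [b]) C ↔ IsCrossing A P A' Q C ∨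
      (a ≠ b ∧ ∃ P₁ Q₁ W, P = P₁ ++ [a] ++ W ∧ Q = Q₁ ++ [b] ++ W ∧
        endPoint A (P₁ ++ [a]) = C ∧ endPoint A' (Q₁ ++ [b]) = C) := by
  constructor
  · rintro ⟨P₁, P₂, Q₁, Q₂, W, s, t, hst, h₁, h₂, h₃, h₄⟩
    have hl := length_eq_of_endPoint_eq hA h₃ h₄
    have l₁ := congrArg List.length h₁
    have l₂ := congrArg List.length h₂
    rcases List.eq_nil_or_concat' P₂ with rfl | ⟨P₂, x, rfl⟩
    · have hQ₂ : Q₂ = [] := by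
        apply List.length_eq_zero_iff.mp
        simp only [List.length_append, List.length_singleton, List.length_nil] at *
        omega
      subst hQ₂
      rw [List.append_nil, ← List.append_assoc] at h₁ h₂
      have e₁ := List.append_inj' h₁ rfl
      have e₂ := List.append_inj' h₂ rfl
      obtain rfl : a = s := by simpa using e₁.2
      obtain rfl : b = t := by simpa using e₂.2
      exact Or.inr ⟨hst, P₁, Q₁, W, e₁.1, e₂.1, h₃, h₄⟩
    · rcases List.eq_nil_or_concat' Q₂ with rfl | ⟨Q₂, y, rfl⟩
      · exfalso
        simp at *
        omega
      · rw [← List.append_assoc, ← List.append_assoc] at h₁ h₂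
        have e₁ := (List.append_inj' h₁ rfl).1
        have e₂ := (List.append_inj' h₂ rfl).1
        rw [List.append_assoc] at e₁ e₂
        exact Or.inl ⟨P₁, P₂, Q₁, Q₂, W, s, t, hst, e₁, e₂, h₃, h₄⟩
  · rintro (⟨P₁, P₂, Q₁, Q₂, W, s, t, hst, rfl, rfl, h₃, h₄⟩ |
      ⟨hab, P₁, Q₁, W, rfl, rfl, h₃, h₄⟩)
    · exact ⟨P₁, P₂ ++ [a], Q₁, Q₂ ++ [b], W, s, t, hst, by simp, by simp, h₃, h₄⟩
    · exact ⟨P₁, [], Q₁, [], W, a, b, hab, by simp, by simp, h₃, h₄⟩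

open Classical in
/-- The effect on the number of crossings of appending a step to each of two paths that have
made equally many steps: a crossing is completed exactly when the paths are at a common point and
repeat the steps of their last disagreement. -/
theorem cro_concat {A A' : ℤ × ℤ} (hA : A.1 + A.2 = A'.1 + A'.2)
    {P Q : List Step} (h : P.length = Q.length) (a b : Step) :
    cro A (P ++ [a]) A' (Q ++ [b]) = cro A P A' Q +
      if a ≠ b ∧ (endPoint A P).1 = (endPoint A' Q).1 ∧ LastDis a b P Q then 1 else 0 := by
  unfold cro
  simp only [isCrossing_concat_iff hA h]
  split_ifs with hc
  -- The completed crossing is the vertex reached by the steps of the last disagreement.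
  · obtain ⟨hab, he, P₁, Q₁, W, rfl, rfl⟩ := hc
    rw [← endPoint_eq_iff hA h, endPoint_append A, endPoint_append A'] at he
    have he' := add_right_cancel he
    have : {C | IsCrossing A (P₁ ++ [a] ++ W) A' (Q₁ ++ [b] ++ W) C ∨
        a ≠ b ∧ ∃ P₁' Q₁' W', P₁ ++ [a] ++ W = P₁' ++ [a] ++ W' ∧
          Q₁ ++ [b] ++ W = Q₁' ++ [b] ++ W' ∧
          endPoint A (P₁' ++ [a]) = C ∧ endPoint A' (Q₁' ++ [b]) = C} =
        insert (endPoint A (P₁ ++ [a]))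
          {C | IsCrossing A (P₁ ++ [a] ++ W) A' (Q₁ ++ [b] ++ W) C} := by
      ext C
      simp only [Set.mem_ofPred_eq, Set.mem_insert_iff]
      rw [or_comm]
      apply or_congr_left
      constructor
      · rintro ⟨-, P₁', Q₁', W', e₁, e₂, e₃, -⟩
        obtain rfl := commonTail_unique hab e₁ e₂
        rw [List.append_cancel_right e₁, e₃]
      · rintro rfl
        exact ⟨hab, P₁, Q₁, W, rfl, rfl, rfl, he'.symm⟩
    rw [this, Set.ncard_insert_of_notMem _ (finite_isCrossing _ _ _ _)]
    -- It is no crossing of the shorter words: after it, they do not disagree any more.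
    rintro ⟨P₁', P₂, Q₁', Q₂, W', s, t, hst, e₁, e₂, e₃, e₄⟩
    have l₁ := length_eq_of_endPoint_eq (A := A) (A' := A) rfl e₃ rfl
    have l₂ := length_eq_of_endPoint_eq (A := A') (A' := A') rfl e₄ he'.symm
    have f₁ := (List.append_inj e₁ l₁.symm).2
    have f₂ := (List.append_inj e₂ l₂.symm).2
    rw [f₁, List.append_assoc, List.append_assoc] at f₂
    have := List.append_cancel_left f₂
    simp at this
    exact hst this.1
  · rw [add_zero]
    congr 1
    ext C
    simp only [Set.mem_ofPred_eq, or_iff_left_iff_imp]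
    rintro ⟨hab, P₁, Q₁, W, rfl, rfl, e₃, e₄⟩
    refine absurd ⟨hab, ?_, P₁, Q₁, W, rfl, rfl⟩ hc
    rw [endPoint_append A, endPoint_append A', e₃, e₄]

/-- Steps of one path after the end of the other do not affect the crossings. -/
theorem cro_concat_left {A A' : ℤ × ℤ} (hA : A.1 + A.2 = A'.1 + A'.2)
    {P Q : List Step} (h : Q.length ≤ P.length) (a : Step) :
    cro A (P ++ [a]) A' Q = cro A P A' Q := by
  unfold cro
  congr 1
  ext C
  constructor
  · rintro ⟨P₁, P₂, Q₁, Q₂, W, s, t, hst, h₁, h₂, h₃, h₄⟩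
    have hl := length_eq_of_endPoint_eq hA h₃ h₄
    have l₁ := congrArg List.length h₁
    have l₂ := congrArg List.length h₂
    rcases List.eq_nil_or_concat' P₂ with rfl | ⟨P₂, x, rfl⟩
    · exfalso
      simp at *
      omega
    · rw [← List.append_assoc, ← List.append_assoc] at h₁
      have e₁ := (List.append_inj' h₁ rfl).1
      rw [List.append_assoc] at e₁
      exact ⟨P₁, P₂, Q₁, Q₂, W, s, t, hst, e₁, h₂, h₃, h₄⟩
  · rintro ⟨P₁, P₂, Q₁, Q₂, W, s, t, hst, rfl, h₂, h₃, h₄⟩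
    exact ⟨P₁, P₂ ++ [a], Q₁, Q₂, W, s, t, hst, by simp, h₂, h₃, h₄⟩

theorem cro_nil (A A' : ℤ × ℤ) : cro A [] A' [] = 0 := by
  have : {C | IsCrossing A [] A' [] C} = ∅ := by
    ext C
    simp only [Set.mem_ofPred_eq, Set.mem_empty_iff_false, iff_false]
    rintro ⟨P₁, P₂, Q₁, Q₂, W, s, t, hst, h₁, -⟩
    simp at h₁
  rw [cro, this, Set.ncard_empty]

theorem cro_self (A : ℤ × ℤ) (P : List Step) : cro A P A P = 0 := by
  induction P using List.reverseRecOn with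
  | nil => exact cro_nil A A
  | append_singleton P a ih => rw [cro_concat rfl rfl, ih]; simp

theorem not_lastDis_and_lastDis {P Q : List Step} (h : P.length = Q.length) :
    ¬ (LastDis .E .N P Q ∧ LastDis .N .E P Q) := by
  refine snoc_induction₂ (p := fun P Q => ¬ (LastDis .E .N P Q ∧ LastDis .N .E P Q))
    (fun h => not_lastDis_nil _ _ h.1) (fun P Q a b _ ih => ?_) P Q h
  rw [lastDis_concat_iff, lastDis_concat_iff]
  cases a <;> cases b <;> simp_all

theorem lastDis_or_lastDis_or_eq {P Q : List Step} (h : P.length = Q.length) :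
    LastDis .E .N P Q ∨ LastDis .N .E P Q ∨ P = Q := by
  refine snoc_induction₂ (p := fun P Q => LastDis .E .N P Q ∨ LastDis .N .E P Q ∨ P = Q)
    (Or.inr (Or.inr rfl)) (fun P Q a b _ ih => ?_) P Q h
  rw [lastDis_concat_iff, lastDis_concat_iff]
  cases a <;> cases b <;> simp_all

/-- `LastWest A P A' Q`: the last time the two paths (of equal length, from points of the same
antidiagonal) were at different points, the path `P` was to the west of `Q`. -/
def LastWest (A : ℤ × ℤ) (P : List Step) (A' : ℤ × ℤ) (Q : List Step) : Prop :=
  (endPoint A P).1 < (endPoint A' Q).1 ∨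
    (endPoint A P).1 = (endPoint A' Q).1 ∧ LastDis .E .N P Q

theorem not_lastWest_and_lastWest {A A' : ℤ × ℤ} {P Q : List Step} (h : P.length = Q.length) :
    ¬ (LastWest A P A' Q ∧ LastWest A' Q A P) := by
  rintro ⟨h₁ | ⟨h₁, h₁'⟩, h₂ | ⟨h₂, h₂'⟩⟩
  · omega
  · omega
  · omega
  · exact not_lastDis_and_lastDis h ⟨h₁', h₂'.symm⟩

theorem lastWest_or_lastWest_or_eq (A A' : ℤ × ℤ) {P Q : List Step} (h : P.length = Q.length) :
    LastWest A P A' Q ∨ LastWest A' Q A P ∨ P = Q := by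
  rcases lt_trichotomy (endPoint A P).1 (endPoint A' Q).1 with h₁ | h₁ | h₁
  · exact Or.inl (Or.inl h₁)
  · rcases lastDis_or_lastDis_or_eq h with h₂ | h₂ | h₂
    · exact Or.inl (Or.inr ⟨h₁, h₂⟩)
    · exact Or.inr (Or.inl (Or.inr ⟨h₁.symm, h₂.symm⟩))
    · exact Or.inr (Or.inr h₂)
  · exact Or.inr (Or.inl (Or.inl h₁))

theorem lastWest_or_lastWest {A A' : ℤ × ℤ} (hA : A.1 < A'.1) {P Q : List Step}
    (h : P.length = Q.length) : LastWest A P A' Q ∨ LastWest A' Q A P := by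
  rcases lastWest_or_lastWest_or_eq A A' h with h₁ | h₁ | rfl
  · exact Or.inl h₁
  · exact Or.inr h₁
  · refine Or.inl (Or.inl ?_)
    simpa [endPoint] using hA

/-- If `P` starts to the west of `Q`, then it was last seen to the west of `Q` exactly when the
number of crossings is even. -/
theorem even_cro_iff {A A' : ℤ × ℤ} (hA : A.1 + A.2 = A'.1 + A'.2) (hlt : A.1 < A'.1)
    {P Q : List Step} (h : P.length = Q.length) :
    Even (cro A P A' Q) ↔ LastWest A P A' Q := by
  refine snoc_induction₂ (p := fun P Q => Even (cro A P A' Q) ↔ LastWest A P A' Q)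
    ?_ (fun P Q a b hl ih => ?_) P Q h
  · simp [cro_nil, LastWest, endPoint, hlt]
  · have h₁ := lastWest_or_lastWest hlt hl
    have h₂ := not_lastWest_and_lastWest (A := A) (A' := A') hl
    have hs : LastDis .N .E P Q ↔ LastDis .E .N Q P := ⟨LastDis.symm, LastDis.symm⟩
    rw [cro_concat hA hl]
    unfold LastWest at *
    rw [endPoint_concat, endPoint_concat, lastDis_concat_iff]
    split_ifs with hc
    · obtain ⟨hab, he, hd⟩ := hc
      rw [Nat.even_add_one, ih]
      cases a <;> cases b <;> simp_all [Step.vec]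
    · rw [add_zero, ih]
      cases a <;> cases b <;> simp [Step.vec, hs] at hc ⊢
      · grind
      · grind

open Classical in
/-- The number of crossings that the two paths will have if they continue in such a way that `P`
is to the east of `Q` the next time they are at different points. -/
noncomputable def eastCro (A : ℤ × ℤ) (P : List Step) (A' : ℤ × ℤ) (Q : List Step) : ℕ :=
  cro A P A' Q + if LastWest A P A' Q then 1 else 0

theorem eastCro_of_lt {A A' : ℤ × ℤ} {P Q : List Step}
    (h : (endPoint A' Q).1 < (endPoint A P).1) : eastCro A P A' Q = cro A P A' Q := by
  rw [eastCro, if_neg, add_zero]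
  rintro (h' | ⟨h', -⟩) <;> omega

/-- As long as `P` stays weakly to the east of `Q`, the crossings seen from the east do not
change. -/
theorem eastCro_concat_of_le {A A' : ℤ × ℤ} (hA : A.1 + A.2 = A'.1 + A'.2)
    {P Q : List Step} (hl : P.length = Q.length) (a b : Step)
    (h : (endPoint A' Q).1 ≤ (endPoint A P).1)
    (h' : (endPoint A' (Q ++ [b])).1 ≤ (endPoint A (P ++ [a])).1) :
    eastCro A (P ++ [a]) A' (Q ++ [b]) = eastCro A P A' Q := by
  unfold eastCro LastWest
  rw [cro_concat hA hl]
  rw [endPoint_concat, endPoint_concat] at *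
  rw [lastDis_concat_iff]
  simp only [Prod.fst_add] at *
  by_cases he : (endPoint A P).1 = (endPoint A' Q).1 <;> by_cases hd : LastDis .E .N P Q <;>
    cases a <;> cases b <;> split_ifs <;> simp_all [Step.vec] <;> omega

/-- When the path `P` catches up with `Q` from the west, the crossing that will be completed
if `P` goes on to the east of `Q` is counted. -/
theorem eastCro_concat_of_eq {A A' : ℤ × ℤ} (hA : A.1 + A.2 = A'.1 + A'.2)
    {P Q : List Step} (hl : P.length = Q.length)
    (h : (endPoint A' Q).1 = (endPoint A P).1 + 1) :
    eastCro A (P ++ [.E]) A' (Q ++ [.N]) = eastCro A' Q A P + 1 := by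
  rw [eastCro_of_lt (by omega : (endPoint A P).1 < (endPoint A' Q).1), cro_comm A' A]
  unfold eastCro
  have hne : (endPoint A P).1 ≠ (endPoint A' Q).1 := by omega
  rw [cro_concat hA hl, if_neg (by simp [hne]), if_pos, add_zero]
  refine Or.inr ⟨?_, lastDis_concat_iff.mpr (Or.inl ⟨rfl, rfl⟩)⟩
  rw [endPoint_concat, endPoint_concat, Prod.fst_add, Prod.fst_add, h]
  simp [Step.vec]

/-! ### The major index and sums over words -/

theorem maj_concat (w : List Step) (a : Step) :
    maj (w ++ [a]) = maj w + if a = .N ∧ w.getLast? = some .E then w.length else 0 := by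
  unfold maj
  rcases List.eq_nil_or_concat' w with rfl | ⟨w, b, rfl⟩
  · simp
  · simp only [Finset.sum_filter, List.length_append, List.length_singleton,
      Finset.sum_range_succ]
    have h : ∀ i ∈ Finset.range w.length,
        (if (w ++ [b] ++ [a])[i]? = some Step.E ∧ (w ++ [b] ++ [a])[i + 1]? = some Step.N
          then i + 1 else 0) =
        if (w ++ [b])[i]? = some Step.E ∧ (w ++ [b])[i + 1]? = some Step.N then i + 1 else 0 := by
      intro i hi
      have hi := Finset.mem_range.mp hi
      have hl : (w ++ [b]).length = w.length + 1 := by simp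
      rw [List.getElem?_append_left (l₂ := [a]) (by omega),
        List.getElem?_append_left (l₂ := [a]) (by omega)]
    rw [Finset.sum_congr rfl h]
    cases a <;> cases b <;> simp

theorem maj_concat_E (w : List Step) : maj (w ++ [.E]) = maj w := by simp [maj_concat]

theorem maj_concat_E_N (w : List Step) : maj (w ++ [.E] ++ [.N]) = maj w + (w.length + 1) := by
  rw [maj_concat, maj_concat_E]; simp

theorem maj_concat_N_N (w : List Step) : maj (w ++ [.N] ++ [.N]) = maj (w ++ [.N]) := by
  rw [maj_concat]; simp

/-- The words of length `n`. -/
noncomputable def words (n : ℕ) : Finset (List Step) := (List.finite_length_eq Step n).toFinset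

theorem mem_words {n : ℕ} {w : List Step} : w ∈ words n ↔ w.length = n := by
  simp [words]

theorem words_zero : words 0 = {[]} := by
  ext w; simp [mem_words]

theorem sum_words_succ {M : Type*} [AddCommMonoid M] (n : ℕ) (φ : List Step → M) :
    ∑ w ∈ words (n + 1), φ w = ∑ w ∈ words n, (φ (w ++ [.E]) + φ (w ++ [.N])) := by
  classical
  have h : words (n + 1) =
      (words n).image (fun w => w ++ [.E]) ∪ (words n).image (fun w => w ++ [.N]) := by
    ext w
    simp only [Finset.mem_union, Finset.mem_image, mem_words]
    constructor
    · intro h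
      rcases List.eq_nil_or_concat' w with rfl | ⟨w, a, rfl⟩
      · simp at h
      · have h' : w.length = n := by simpa using h
        cases a
        · exact Or.inr ⟨w, h', rfl⟩
        · exact Or.inl ⟨w, h', rfl⟩
    · rintro (⟨w, rfl, rfl⟩ | ⟨w, rfl, rfl⟩) <;> simp
  rw [h, Finset.sum_union, Finset.sum_image, Finset.sum_image, Finset.sum_add_distrib]
  · intro v _ w _ h; simpa using h
  · intro v _ w _ h; simpa using h
  · rw [Finset.disjoint_left]
    intro w h₁ h₂
    simp only [Finset.mem_image] at h₁ h₂
    obtain ⟨v, -, rfl⟩ := h₁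
    obtain ⟨v', -, h⟩ := h₂
    have := (List.append_inj' h rfl).2
    simp at this

/-- The weight `q ^ maj w` (for `i = false`) or `q ^ maj (w N)` (for `i = true`) of a word. -/
noncomputable def wt (i : Bool) (w : List Step) : RatFunc ℚ :=
  RatFunc.X ^ maj (if i then w ++ [.N] else w)

/-- The factor that the weight `wt i` gains when a step `E` is appended to a word of
length `n`. -/
noncomputable def stepE (i : Bool) (n : ℕ) : RatFunc ℚ := if i then RatFunc.X ^ (n + 1) else 1

theorem wt_concat_E (i : Bool) (w : List Step) :
    wt i (w ++ [.E]) = stepE i w.length * wt false w := by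
  cases i
  · simp [wt, stepE, maj_concat_E]
  · simp only [wt, stepE, if_true, maj_concat_E_N, Bool.false_eq_true, if_false, pow_add, mul_comm]

theorem wt_concat_N (i : Bool) (w : List Step) : wt i (w ++ [.N]) = wt true w := by
  cases i
  · simp [wt]
  · simp only [wt, if_true, maj_concat_N_N]

/-! ### Gaussian binomial coefficients -/

theorem one_sub_X_pow_ne_zero {n : ℕ} (hn : n ≠ 0) : (1 : RatFunc ℚ) - RatFunc.X ^ n ≠ 0 := by
  intro h
  have h' : (algebraMap ℚ[X] (RatFunc ℚ)) (1 - X ^ n) = 0 := by simpa using h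
  rw [map_eq_zero_iff _ (RatFunc.algebraMap_injective ℚ)] at h'
  have := congrArg (Polynomial.eval 0) h'
  simp [hn] at this

/-- The `q`-factorial, up to a power of `1 - q`. -/
noncomputable def qfact (n : ℕ) : RatFunc ℚ := ∏ i ∈ Finset.range n, (1 - RatFunc.X ^ (i + 1))

theorem qfact_ne_zero (n : ℕ) : qfact n ≠ 0 :=
  Finset.prod_ne_zero_iff.mpr fun i _ => one_sub_X_pow_ne_zero (Nat.succ_ne_zero i)

theorem qfact_succ (n : ℕ) : qfact (n + 1) = qfact n * (1 - RatFunc.X ^ (n + 1)) :=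
  Finset.prod_range_succ _ _

theorem prod_mul_qfact (m k : ℕ) :
    (∏ i ∈ Finset.range k, ((1 : RatFunc ℚ) - RatFunc.X ^ (m + k - i))) * qfact m =
      qfact (m + k) := by
  induction k with
  | zero => simp
  | succ k ih =>
    rw [Finset.prod_range_succ', Nat.sub_zero, ← add_assoc, qfact_succ, ← ih, mul_right_comm]
    congr 2
    refine Finset.prod_congr rfl fun i _ => ?_
    rw [Nat.add_sub_add_right]

theorem qbinom_add (m k : ℕ) :
    qbinom ((m : ℤ) + k) k = qfact (m + k) / (qfact k * qfact m) := by
  have h₁ := prod_mul_qfact m k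
  have h₂ := prod_mul_qfact 0 k
  simp only [zero_add, qfact, Finset.range_zero, Finset.prod_empty, mul_one] at h₂
  rw [qbinom, if_pos (by omega), ← h₁]
  have e : ((m : ℤ) + k).toNat = m + k := by omega
  simp only [e, Int.toNat_natCast, h₂]
  change _ / qfact k = _
  have := qfact_ne_zero m
  have := qfact_ne_zero k
  field_simp

theorem qbinom_of_neg {n k : ℤ} (h : k < 0) : qbinom n k = 0 := if_neg (by omega)

theorem qbinom_of_lt {n k : ℤ} (h : n < k) : qbinom n k = 0 := if_neg (by omega)

theorem qbinom_zero_left (k : ℤ) : qbinom 0 k = if k = 0 then 1 else 0 := by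
  split_ifs with h
  · subst h; simp [qbinom]
  · exact if_neg (by omega)

/-- Both `q`-Pascal recurrences, the second one multiplied by a power of `q`. -/
theorem qbinom_succ (n : ℕ) (k : ℤ) :
    qbinom (n + 1 : ℕ) k = qbinom n (k - 1) + RatFunc.X ^ k * qbinom n k ∧
      RatFunc.X ^ k * qbinom (n + 1 : ℕ) k =
        RatFunc.X ^ (n + 1) * qbinom n (k - 1) + RatFunc.X ^ k * qbinom n k := by
  rcases lt_or_ge k 0 with hk | hk
  · rw [qbinom_of_neg hk, qbinom_of_neg hk, qbinom_of_neg (by omega)]; simp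
  rcases lt_or_ge (n + 1 : ℤ) k with hn | hn
  · rw [qbinom_of_lt (by push_cast; omega), qbinom_of_lt (by omega : (n : ℤ) < k - 1),
      qbinom_of_lt (by omega)]
    simp
  lift k to ℕ using hk
  rcases k with _ | k
  · rw [qbinom_of_neg (k := (0 : ℕ) - 1) (by omega)]
    have h₁ := qbinom_add (n + 1) 0
    have h₂ := qbinom_add n 0
    have := qfact_ne_zero n
    have := qfact_ne_zero (n + 1)
    simp only [Nat.cast_zero, add_zero, qfact, Finset.range_zero, Finset.prod_empty, one_mul]
      at h₁ h₂ ⊢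
    change _ = qfact _ / qfact _ at h₁
    change _ = qfact _ / qfact _ at h₂
    rw [h₁, h₂]
    field_simp
    simp
  · obtain ⟨m, rfl⟩ : ∃ m, n = m + k := ⟨n - k, by omega⟩
    have e₁ : qbinom ((m + k + 1 : ℕ) : ℤ) ((k + 1 : ℕ) : ℤ) =
        qfact (m + (k + 1)) / (qfact (k + 1) * qfact m) := by
      rw [← qbinom_add m (k + 1)]; push_cast; ring_nf
    have e₂ : qbinom ((m + k : ℕ) : ℤ) (((k + 1 : ℕ) : ℤ) - 1) =
        qfact (m + k) / (qfact k * qfact m) := by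
      rw [← qbinom_add m k]; push_cast; ring_nf
    have e₃ : qbinom ((m + k : ℕ) : ℤ) ((k + 1 : ℕ) : ℤ) =
        qfact (m + k) * (1 - RatFunc.X ^ m) / (qfact (k + 1) * qfact m) := by
      rcases m with _ | m
      · rw [qbinom_of_lt (by omega)]; simp
      · have := qbinom_add m (k + 1)
        have hm := one_sub_X_pow_ne_zero (Nat.succ_ne_zero m)
        have := qfact_ne_zero m
        have := qfact_ne_zero (k + 1)
        rw [qfact_succ m, show m + 1 + k = m + (k + 1) by ring, Nat.cast_add, qbinom_add m (k + 1)]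
        field_simp
    rw [e₁, e₂, e₃, ← add_assoc, qfact_succ, qfact_succ k, zpow_natCast]
    have := qfact_ne_zero m
    have := qfact_ne_zero k
    have := qfact_ne_zero (m + k)
    have := one_sub_X_pow_ne_zero (Nat.succ_ne_zero k)
    constructor <;> field_simp <;> ring

/-! ### Generating functions of pairs of words -/

open Classical in
/-- The generating function of the pairs of words `P`, `Q` of lengths `n`, `n'` that satisfy the
condition `c` and lead from `A` to abscissa `b` and from `A'` to abscissa `b'`, respectively, with
respect to the weights `wt i` and `wt j`. -/
noncomputable def pairGF (c : List Step → List Step → Prop) (A A' : ℤ × ℤ) (n n' : ℕ) (b b' : ℤ)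
    (i j : Bool) : RatFunc ℚ :=
  ∑ P ∈ words n, ∑ Q ∈ words n',
    if (endPoint A P).1 = b ∧ (endPoint A' Q).1 = b' ∧ c P Q then wt i P * wt j Q else 0

theorem pairGF_congr {c c' : List Step → List Step → Prop} {A A' : ℤ × ℤ} {n n' : ℕ} {b b' : ℤ}
    {i j : Bool} (h : ∀ P Q, P.length = n → Q.length = n' → (endPoint A P).1 = b →
      (endPoint A' Q).1 = b' → (c P Q ↔ c' P Q)) :
    pairGF c A A' n n' b b' i j = pairGF c' A A' n n' b b' i j := by
  classical
  refine Finset.sum_congr rfl fun P hP => Finset.sum_congr rfl fun Q hQ => if_congr ?_ rfl rfl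
  constructor
  · rintro ⟨h₁, h₂, h₃⟩
    exact ⟨h₁, h₂, (h P Q (mem_words.mp hP) (mem_words.mp hQ) h₁ h₂).mp h₃⟩
  · rintro ⟨h₁, h₂, h₃⟩
    exact ⟨h₁, h₂, (h P Q (mem_words.mp hP) (mem_words.mp hQ) h₁ h₂).mpr h₃⟩

theorem pairGF_comm (c : List Step → List Step → Prop) (A A' : ℤ × ℤ) (n n' : ℕ) (b b' : ℤ)
    (i j : Bool) :
    pairGF c A A' n n' b b' i j = pairGF (fun Q P => c P Q) A' A n' n b' b j i := by
  classical
  unfold pairGF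
  rw [Finset.sum_comm]
  refine Finset.sum_congr rfl fun P _ => Finset.sum_congr rfl fun Q _ => ?_
  rw [mul_comm]
  exact if_congr and_left_comm rfl rfl

theorem pairGF_succ_left (c : List Step → List Step → Prop) (A A' : ℤ × ℤ) (n n' : ℕ) (b b' : ℤ)
    (i j : Bool) :
    pairGF c A A' (n + 1) n' b b' i j =
      stepE i n * pairGF (fun P Q => c (P ++ [.E]) Q) A A' n n' (b - 1) b' false j +
        pairGF (fun P Q => c (P ++ [.N]) Q) A A' n n' b b' true j := by
  classical
  unfold pairGF
  rw [sum_words_succ, Finset.sum_add_distrib, Finset.mul_sum]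
  congr 1
  · refine Finset.sum_congr rfl fun P hP => ?_
    rw [Finset.mul_sum]
    refine Finset.sum_congr rfl fun Q _ => ?_
    rw [mul_ite, mul_zero, wt_concat_E, mem_words.mp hP, mul_assoc, endPoint_concat]
    refine if_congr (and_congr_left fun _ => ?_) rfl rfl
    simp only [Step.vec, Prod.fst_add]
    omega
  · refine Finset.sum_congr rfl fun P hP => Finset.sum_congr rfl fun Q _ => ?_
    rw [wt_concat_N, endPoint_concat]
    refine if_congr (and_congr_left fun _ => ?_) rfl rfl
    simp [Step.vec]

theorem pairGF_succ_right (c : List Step → List Step → Prop) (A A' : ℤ × ℤ) (n n' : ℕ) (b b' : ℤ)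
    (i j : Bool) :
    pairGF c A A' n (n' + 1) b b' i j =
      stepE j n' * pairGF (fun P Q => c P (Q ++ [.E])) A A' n n' b (b' - 1) i false +
        pairGF (fun P Q => c P (Q ++ [.N])) A A' n n' b b' i true := by
  rw [pairGF_comm, pairGF_succ_left, pairGF_comm _ A' A n' n (b' - 1), pairGF_comm _ A' A n' n b']

/-- A `q`-binomial coefficient, multiplied by a power of `q` if `i = true`. It is the generating
function of the words of length `n` with `k` east steps for the weight `wt i`. -/
noncomputable def gauss (i : Bool) (n : ℕ) (k : ℤ) : RatFunc ℚ :=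
  (if i then RatFunc.X ^ k else 1) * qbinom n k

theorem gauss_succ (i : Bool) (n : ℕ) (k : ℤ) :
    gauss i (n + 1) k = stepE i n * gauss false n (k - 1) + gauss true n k := by
  have h := qbinom_succ n k
  cases i <;> simp only [gauss, stepE, if_true, Bool.false_eq_true, if_false, one_mul]
  · exact h.1
  · exact h.2

theorem gauss_zero (i : Bool) (k : ℤ) : gauss i 0 k = if k = 0 then 1 else 0 := by
  rw [gauss, Nat.cast_zero, qbinom_zero_left]
  by_cases h : k = 0 <;> simp [h]

/-- Extending the first word by steps that do not influence the condition `c` changes the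
generating function like that of the first word alone. -/
theorem pairGF_extend_left {c : List Step → List Step → Prop} {A A' : ℤ × ℤ} {m n' : ℕ}
    {b' : ℤ} {j : Bool} (hc : ∀ P Q a, m ≤ P.length → Q.length = n' → (c (P ++ [a]) Q ↔ c P Q))
    (s : ℤ) (K : RatFunc ℚ) (l : ℕ) (b : ℤ) (i : Bool)
    (h : ∀ i b₀, b - l ≤ b₀ → b₀ ≤ b →
      pairGF c A A' m n' b₀ b' i j = gauss i m (b₀ - s) * K) :
    pairGF c A A' (m + l) n' b b' i j = gauss i (m + l) (b - s) * K := by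
  induction l generalizing b i with
  | zero => exact h i b (by simp) le_rfl
  | succ l ih =>
    have e : ∀ a b₁, pairGF (fun P Q => c (P ++ [a]) Q) A A' (m + l) n' b₁ b' =
        pairGF c A A' (m + l) n' b₁ b' := by
      intro a b₁
      funext i j
      exact pairGF_congr fun P Q hP hQ _ _ => hc P Q a (by omega) hQ
    rw [← add_assoc, pairGF_succ_left, e, e, gauss_succ,
      ih (b - 1) false fun i b₀ h₁ h₂ => h i b₀ (by push_cast; omega) (by omega),
      ih b true fun i b₀ h₁ h₂ => h i b₀ (by push_cast; omega) (by omega), sub_right_comm]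
    ring

/-- Without a condition the generating function of pairs is a product. -/
theorem pairGF_of_forall {c : List Step → List Step → Prop} {A A' : ℤ × ℤ} {n n' : ℕ}
    (hc : ∀ P Q, P.length = n → Q.length = n' → c P Q) (b b' : ℤ) (i j : Bool) :
    pairGF c A A' n n' b b' i j = gauss i n (b - A.1) * gauss j n' (b' - A'.1) := by
  rw [pairGF_congr (c' := fun _ _ => True) fun P Q hP hQ _ _ => iff_true_intro (hc P Q hP hQ)]
  have base : ∀ i j b b', pairGF (fun _ _ => True) A A' 0 0 b b' i j =
      gauss i 0 (b - A.1) * gauss j 0 (b' - A'.1) := by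
    intro i j b b'
    have h : ∀ i, wt i [] = 1 := by
      intro i
      cases i <;> simp [wt, maj]
    simp only [pairGF, words_zero, Finset.sum_singleton, h, gauss_zero, endPoint, List.map_nil,
      List.sum_nil, add_zero, and_true, mul_one]
    have e : ∀ x y : ℤ, x - y = 0 ↔ y = x := fun x y => by omega
    by_cases h₁ : A.1 = b <;> by_cases h₂ : A'.1 = b' <;> simp [h₁, h₂, e]
  have left : ∀ n i j b b', pairGF (fun _ _ => True) A A' n 0 b b' i j =
      gauss i n (b - A.1) * gauss j 0 (b' - A'.1) := by
    intro n i j b b'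
    have := pairGF_extend_left (c := fun _ _ => True) (A := A) (A' := A') (m := 0) (n' := 0)
      (b' := b') (j := j) (fun _ _ _ _ _ => Iff.rfl) A.1 (gauss j 0 (b' - A'.1)) n b i
      (fun i b₀ _ _ => base i j b₀ b')
    simpa only [zero_add] using this
  have := pairGF_extend_left (c := fun _ _ => True) (A := A') (A' := A) (m := 0) (n' := n)
      (b' := b) (j := i) (fun _ _ _ _ _ => Iff.rfl) A'.1 (gauss i n (b - A.1)) n' b' j
      (fun j b₀ _ _ => by rw [pairGF_comm, left, mul_comm])
  rw [pairGF_comm, mul_comm]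
  simpa only [zero_add] using this

/-! ### Pairs of words by crossings seen from the east -/

/-- The product of two `q`-binomial coefficients that counts pairs of paths with crossings; the
starting points are moved by `ρ` in opposite directions along their antidiagonal. -/
noncomputable def shiftedGF (ρ : ℤ) (A A' : ℤ × ℤ) (n n' : ℕ) (b b' : ℤ) (i j : Bool) :
    RatFunc ℚ :=
  RatFunc.X ^ (ρ * (ρ + A'.1 - A.1)) * gauss i n (b - A.1 + ρ) * gauss j n' (b' - A'.1 - ρ)

theorem shiftedGF_zero (A A' : ℤ × ℤ) (n n' : ℕ) (b b' : ℤ) (i j : Bool) :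
    shiftedGF 0 A A' n n' b b' i j = gauss i n (b - A.1) * gauss j n' (b' - A'.1) := by
  simp [shiftedGF]

/-- The reflection principle: one step before the paths meet, the two factors for `(A', A)` and
the two factors for `(A, A')` are the same `q`-binomial coefficients in exchanged order, and the
powers of `q` agree provided that the path about to step north carries the weight `wt true`. -/
theorem shiftedGF_reflect (ρ : ℤ) (A A' : ℤ × ℤ) (n : ℕ) (x : ℤ) :
    shiftedGF (ρ - 1 + (A'.1 - A.1)) A' A n n (x + 1) x true false =
      shiftedGF ρ A A' n n x (x + 1) false true := by
  unfold shiftedGF gauss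
  have e₁ : x + 1 - A'.1 + (ρ - 1 + (A'.1 - A.1)) = x - A.1 + ρ := by ring
  have e₂ : x - A.1 - (ρ - 1 + (A'.1 - A.1)) = x + 1 - A'.1 - ρ := by ring
  rw [e₁, e₂]
  simp only [if_true, Bool.false_eq_true, if_false, one_mul]
  have hX : (RatFunc.X : RatFunc ℚ) ≠ 0 := RatFunc.X_ne_zero
  rw [← mul_assoc, ← zpow_add₀ hX, mul_mul_mul_comm, mul_comm (qbinom _ _), ← zpow_add₀ hX]
  rw [mul_assoc, mul_comm (qbinom _ _)]
  congr 2
  ring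

/-- The generating function of pairs of words of equal length with at least `k` crossings seen
from the east. -/
noncomputable def eastGF (k : ℕ) (A A' : ℤ × ℤ) (n : ℕ) (b b' : ℤ) (i j : Bool) : RatFunc ℚ :=
  pairGF (fun P Q => k ≤ eastCro A P A' Q) A A' n n b b' i j

/-- If the pairs with at least `k` crossings seen from the other side are known, then so are the
pairs with at least `k + 1` crossings, as long as `P` ends weakly to the east of `Q`: the
generating functions on both sides satisfy the same recurrence, and they agree on the pairs that
come from the west. -/
theorem eastGF_succ {A A' : ℤ × ℤ} (hA : A.1 + A.2 = A'.1 + A'.2) {k : ℕ} {ρ : ℤ}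
    (hρ : 0 < 2 * ρ + (A'.1 - A.1))
    (h : ∀ n x, eastGF k A' A n (x + 1) x true false =
      shiftedGF (ρ - 1 + (A'.1 - A.1)) A' A n n (x + 1) x true false)
    (n : ℕ) (b b' : ℤ) (i j : Bool) (hb : b' ≤ b) :
    eastGF (k + 1) A A' n b b' i j = shiftedGF ρ A A' n n b b' i j := by
  induction n generalizing b b' i j with
  | zero =>
    have e₁ : eastGF (k + 1) A A' 0 b b' i j = 0 := by
      simp only [eastGF, pairGF, words_zero, Finset.sum_singleton]
      refine if_neg ?_
      rintro ⟨h₁, h₂, h₃⟩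
      rw [eastCro, cro_nil, if_neg] at h₃
      · omega
      · rintro (h₄ | ⟨-, h₄⟩)
        · omega
        · exact not_lastDis_nil _ _ h₄
    -- `hρ` prevents the shifted product from counting a pair of empty words with `b' ≤ b`.
    rw [e₁, shiftedGF, gauss_zero, gauss_zero]
    split_ifs
    · omega
    all_goals simp
  | succ n ih =>
    have same : ∀ (s t : Step) (b b' : ℤ) (i j : Bool), b' ≤ b →
        b' + t.vec.1 ≤ b + s.vec.1 →
        pairGF (fun P Q => k + 1 ≤ eastCro A (P ++ [s]) A' (Q ++ [t])) A A' n n b b' i j =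
          shiftedGF ρ A A' n n b b' i j := by
      intro s t b b' i j h₁ h₂
      rw [← ih b b' i j h₁]
      refine pairGF_congr fun P Q hP hQ hP' hQ' => ?_
      rw [eastCro_concat_of_le hA (hP.trans hQ.symm) s t (by omega)]
      rw [endPoint_concat, endPoint_concat, Prod.fst_add, Prod.fst_add]
      omega
    -- The step `(E, N)` is the only one that can come from `b < b'`; there the other side's formula
    -- takes over, by reflection.
    have cross : pairGF (fun P Q => k + 1 ≤ eastCro A (P ++ [.E]) A' (Q ++ [.N])) A A' n n
        (b - 1) b' false true = shiftedGF ρ A A' n n (b - 1) b' false true := by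
      rcases hb.eq_or_lt with rfl | hlt
      · have h' := h n (b' - 1)
        rw [shiftedGF_reflect] at h'
        simp only [sub_add_cancel] at h'
        rw [← h', eastGF, pairGF_comm]
        refine pairGF_congr fun Q P hQ hP hQ' hP' => ?_
        rw [eastCro_concat_of_eq hA (hP.trans hQ.symm) (by omega)]
        omega
      · exact same .E .N _ _ _ _ (by omega) (by simp [Step.vec]; omega)
    rw [eastGF, pairGF_succ_left, pairGF_succ_right, pairGF_succ_right, cross,
      same .E .E _ _ _ _ (by omega) (by simp [Step.vec]; omega),
      same .N .E _ _ _ _ (by omega) (by simp [Step.vec]; omega),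
      same .N .N _ _ _ _ (by omega) (by simp [Step.vec]; omega)]
    unfold shiftedGF
    rw [gauss_succ i, gauss_succ j, show b - 1 - A.1 + ρ = b - A.1 + ρ - 1 by ring,
      show b' - 1 - A'.1 - ρ = b' - A'.1 - ρ - 1 by ring]
    ring

theorem eastGF_zero (A A' : ℤ × ℤ) (n : ℕ) (b b' : ℤ) (i j : Bool) :
    eastGF 0 A A' n b b' i j = shiftedGF 0 A A' n n b b' i j := by
  rw [shiftedGF_zero, eastGF]
  exact pairGF_of_forall (fun _ _ _ _ => Nat.zero_le _) b b' i j

/-- For paths with a common starting point the two sides play the same role, and the number of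
crossings is the shift. -/
theorem eastGF_self (k : ℕ) (A : ℤ × ℤ) (n : ℕ) (b b' : ℤ) (i j : Bool) (hb : b' ≤ b) :
    eastGF k A A n b b' i j = shiftedGF k A A n n b b' i j := by
  induction k generalizing n b b' i j with
  | zero => exact eastGF_zero A A n b b' i j
  | succ k ih =>
    refine eastGF_succ rfl (by push_cast; omega) (fun n x => ?_) n b b' i j hb
    rw [ih n (x + 1) x true false (by omega)]
    congr 1
    push_cast
    ring

theorem odd_eastCro {A A' : ℤ × ℤ} (hA : A.1 + A.2 = A'.1 + A'.2) (hlt : A.1 < A'.1)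
    {P Q : List Step} (h : P.length = Q.length) : Odd (eastCro A P A' Q) := by
  have := even_cro_iff hA hlt h
  unfold eastCro
  split_ifs with hw
  · exact (this.mpr hw).add_one
  · rw [add_zero, ← Nat.not_even_iff_odd, this]
    exact hw

theorem even_eastCro {A A' : ℤ × ℤ} (hA : A.1 + A.2 = A'.1 + A'.2) (hlt : A.1 < A'.1)
    {P Q : List Step} (h : P.length = Q.length) : Even (eastCro A' Q A P) := by
  have h₁ := even_cro_iff hA hlt h
  have h₂ := lastWest_or_lastWest hlt h
  have h₃ := not_lastWest_and_lastWest (A := A) (A' := A') h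
  unfold eastCro
  rw [cro_comm]
  split_ifs with hw
  · rw [Nat.even_add_one, h₁]
    exact fun h => h₃ ⟨h, hw⟩
  · exact h₁.mpr (h₂.resolve_right hw)

/-- The crossings seen from the two sides are `cro` and `cro + 1`, in some order. -/
theorem eastCro_eq_or_eq {A A' : ℤ × ℤ} (hlt : A.1 < A'.1)
    {P Q : List Step} (h : P.length = Q.length) :
    (eastCro A P A' Q = cro A P A' Q + 1 ∧ eastCro A' Q A P = cro A P A' Q) ∨
      (eastCro A P A' Q = cro A P A' Q ∧ eastCro A' Q A P = cro A P A' Q + 1) := by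
  have h₂ := lastWest_or_lastWest hlt h
  have h₃ := not_lastWest_and_lastWest (A := A) (A' := A') h
  unfold eastCro
  rw [cro_comm A' A]
  by_cases hw : LastWest A P A' Q <;> by_cases hw' : LastWest A' Q A P <;> simp_all

/-- For paths starting at distinct points `A` and `A'`, with `A` in the west, the two sides
alternate. Crossings seen with the path from `A` in the east are odd in number, and for the bound
`2 * m + 1` the shift is `2 * m`; seen from the other side they are even in number, and for the
bound `2 * m + 2` the shift is `2 * m + 1`, plus the distance of the starting points. -/
theorem eastGF_of_lt {A A' : ℤ × ℤ} (hA : A.1 + A.2 = A'.1 + A'.2) (hlt : A.1 < A'.1) (m : ℕ) :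
    (∀ n b b' i j, b' ≤ b →
      eastGF (2 * m + 1) A A' n b b' i j = shiftedGF (2 * m : ℕ) A A' n n b b' i j) ∧
    (∀ n b b' i j, b' ≤ b → eastGF (2 * m + 2) A' A n b b' i j =
      shiftedGF ((2 * m + 1 : ℕ) + (A'.1 - A.1)) A' A n n b b' i j) := by
  have next : ∀ m : ℕ, (∀ n b b' i j, b' ≤ b →
      eastGF (2 * m + 1) A A' n b b' i j = shiftedGF (2 * m : ℕ) A A' n n b b' i j) →
      ∀ n b b' i j, b' ≤ b → eastGF (2 * m + 2) A' A n b b' i j =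
        shiftedGF ((2 * m + 1 : ℕ) + (A'.1 - A.1)) A' A n n b b' i j := by
    intro m h n b b' i j hb
    refine eastGF_succ hA.symm (by push_cast; omega) (fun n x => ?_) n b b' i j hb
    rw [h n (x + 1) x true false (by omega)]
    congr 1
    push_cast
    ring
  suffices h : ∀ n b b' i j, b' ≤ b →
      eastGF (2 * m + 1) A A' n b b' i j = shiftedGF (2 * m : ℕ) A A' n n b b' i j from
    ⟨h, next m h⟩
  induction m with
  | zero =>
    intro n b b' i j _
    rw [eastGF, mul_zero, Nat.cast_zero, shiftedGF_zero]
    -- Every pair is counted: a path starting in the west has to cross before it is in the east.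
    exact pairGF_of_forall (fun P Q hP hQ => (odd_eastCro hA hlt (hP.trans hQ.symm)).pos) b b' i j
  | succ m ih =>
    intro n b b' i j hb
    refine eastGF_succ hA (by push_cast; omega) (fun n x => ?_) n b b' i j hb
    have := next m ih n (x + 1) x true false (by omega)
    rw [show 2 * (m + 1) = 2 * m + 2 by ring, this]
    congr 1
    push_cast
    ring

/-! ### From words to lattice paths -/

/-- The expression `f r` with an integer `ρ` in place of `r`. Pairs of paths with starting points
in the opposite order are counted by it with `ρ` different from the number of crossings. -/
noncomputable def shiftedF (ρ : ℤ) (A A' B B' : ℤ × ℤ) : RatFunc ℚ :=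
  RatFunc.X ^ (ρ * (ρ + A'.1 - A.1)) *
    qbinom (B.1 - A.1 + B.2 - A.2) (B.1 - A.1 + ρ) *
    qbinom (B'.1 - A'.1 + B'.2 - A'.2) (B'.1 - A'.1 - ρ)

theorem shiftedF_natCast (r : ℕ) (A A' B B' : ℤ × ℤ) : shiftedF r A A' B B' = f r A A' B B' :=
  rfl

/-- Exchanging the starting points amounts to a shift of `ρ`. -/
theorem shiftedF_add {A A' : ℤ × ℤ} (hA : A.1 + A.2 = A'.1 + A'.2) (ρ : ℤ) (B B' : ℤ × ℤ) :
    shiftedF (ρ + (A'.1 - A.1)) A' A B B' = shiftedF ρ A A' B B' := by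
  unfold shiftedF
  congr 1
  · congr 1
    · congr 1; ring
    · congr 1
      · linarith
      · ring
  · congr 1
    · linarith
    · ring

theorem shiftedF_eq_zero {ρ : ℤ} {A A' B B' : ℤ × ℤ}
    (h : B.1 - A.1 + (B.2 - A.2) < 0 ∨ B'.1 - A'.1 + (B'.2 - A'.2) < 0) :
    shiftedF ρ A A' B B' = 0 := by
  have e : ∀ n k : ℤ, n < 0 → qbinom n k = 0 := fun n k hn => if_neg (by omega)
  unfold shiftedF
  rcases h with h | h
  · rw [e (B.1 - A.1 + B.2 - A.2) _ (by omega)]; simp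
  · rw [e (B'.1 - A'.1 + B'.2 - A'.2) _ (by omega)]; simp

theorem shiftedGF_eq_shiftedF {A A' B B' : ℤ × ℤ} {n n' : ℕ}
    (hn : B.1 - A.1 + (B.2 - A.2) = n) (hn' : B'.1 - A'.1 + (B'.2 - A'.2) = n') (ρ : ℤ) :
    shiftedGF ρ A A' n n' B.1 B'.1 false false = shiftedF ρ A A' B B' := by
  simp only [shiftedGF, shiftedF, gauss, Bool.false_eq_true, if_false, one_mul, ← hn, ← hn',
    add_sub_assoc]

theorem sum_lPath {M : Type*} [AddCommMonoid M] {A B : ℤ × ℤ} {n : ℕ}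
    (hn : B.1 - A.1 + (B.2 - A.2) = n) (φ : List Step → M) :
    ∑ P : LPath A B, φ P.1 = ∑ w ∈ words n, if (endPoint A w).1 = B.1 then φ w else 0 := by
  rw [← Finset.sum_filter]
  refine (Finset.sum_subtype _ (fun w => ?_) φ).symm
  rw [Finset.mem_filter, mem_words, Prod.ext_iff]
  have := endPoint_fst_add_snd A w
  constructor
  · rintro ⟨h₁, h₂⟩
    exact ⟨h₂, by omega⟩
  · rintro ⟨h₁, h₂⟩
    exact ⟨by omega, h₁⟩

theorem H_eq_pairGF (r : ℕ) {A B A' B' : ℤ × ℤ} {n n' : ℕ}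
    (hn : B.1 - A.1 + (B.2 - A.2) = n) (hn' : B'.1 - A'.1 + (B'.2 - A'.2) = n') :
    (H r A B A' B' : RatFunc ℚ) =
      pairGF (fun P Q => r ≤ cro A P A' Q) A A' n n' B.1 B'.1 false false := by
  classical
  have e : (H r A B A' B' : RatFunc ℚ) = ∑ P : LPath A B, ∑ Q : LPath A' B',
      if r ≤ cro A P.1 A' Q.1 then wt false P.1 * wt false Q.1 else 0 := by
    rw [← Fintype.sum_prod_type', H, pairs, Finset.sum_filter]
    change algebraMap ℚ[X] (RatFunc ℚ) _ = _
    rw [map_sum]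
    refine Finset.sum_congr rfl fun p _ => ?_
    split_ifs <;> simp [wt, pow_add]
  rw [e, sum_lPath hn (fun P => ∑ Q : LPath A' B',
      if r ≤ cro A P A' Q.1 then wt false P * wt false Q.1 else 0)]
  unfold pairGF
  refine Finset.sum_congr rfl fun P _ => ?_
  rw [sum_lPath hn' (fun Q => if r ≤ cro A P A' Q then wt false P * wt false Q else 0)]
  by_cases h : (endPoint A P).1 = B.1
  · rw [if_pos h]
    refine Finset.sum_congr rfl fun Q _ => ?_
    by_cases h₁ : (endPoint A' Q).1 = B'.1 <;> by_cases h₂ : r ≤ cro A P A' Q <;>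
      simp [h, h₁, h₂]
  · rw [if_neg h]
    exact (Finset.sum_eq_zero fun Q _ => if_neg fun h' => h h'.1).symm

theorem H_eq_zero (r : ℕ) {A B A' B' : ℤ × ℤ}
    (h : B.1 - A.1 + (B.2 - A.2) < 0 ∨ B'.1 - A'.1 + (B'.2 - A'.2) < 0) :
    H r A B A' B' = 0 := by
  have key : ∀ A B : ℤ × ℤ, B.1 - A.1 + (B.2 - A.2) < 0 → LPath A B → False := by
    rintro A B h ⟨w, rfl⟩
    have := endPoint_fst_add_snd A w
    omega
  refine Finset.sum_eq_zero ?_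
  rintro ⟨P, Q⟩ -
  exact (h.elim (fun h => key _ _ h P) fun h => key _ _ h Q).elim

theorem H_comm (r : ℕ) (A B A' B' : ℤ × ℤ) : H r A B A' B' = H r A' B' A B := by
  classical
  unfold H pairs
  rw [Finset.sum_filter, Finset.sum_filter, Fintype.sum_prod_type, Fintype.sum_prod_type_right]
  simp only [cro_comm A A', add_comm]

/-- To prove a formula for `H`, it may be assumed that there are paths. -/
theorem H_eq_shiftedF_of {r : ℕ} {ρ : ℤ} {A B A' B' : ℤ × ℤ}
    (h : ∀ n n' : ℕ, B.1 - A.1 + (B.2 - A.2) = n → B'.1 - A'.1 + (B'.2 - A'.2) = n' →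
      pairGF (fun P Q => r ≤ cro A P A' Q) A A' n n' B.1 B'.1 false false =
        shiftedGF ρ A A' n n' B.1 B'.1 false false) :
    (H r A B A' B' : RatFunc ℚ) = shiftedF ρ A A' B B' := by
  by_cases h₀ : B.1 - A.1 + (B.2 - A.2) < 0 ∨ B'.1 - A'.1 + (B'.2 - A'.2) < 0
  · rw [H_eq_zero r h₀, shiftedF_eq_zero h₀]
    exact map_zero (algebraMap ℚ[X] (RatFunc ℚ))
  · push Not at h₀
    obtain ⟨n, hn⟩ := Int.eq_ofNat_of_zero_le h₀.1
    obtain ⟨n', hn'⟩ := Int.eq_ofNat_of_zero_le h₀.2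
    rw [H_eq_pairGF r hn hn', h n n' hn hn', shiftedGF_eq_shiftedF hn hn']

/-- The passage from pairs of equal length to arbitrary end points `B` strictly southeast of `B'`:
at the end of the shorter path, the path to `B` is already to the east of the path to `B'`, and the
rest of the longer path produces no crossings. -/
theorem H_eq_shiftedF {A A' : ℤ × ℤ} (hA : A.1 + A.2 = A'.1 + A'.2) {r : ℕ} {ρ : ℤ}
    (h : ∀ n b b' i j, b' ≤ b → eastGF r A A' n b b' i j = shiftedGF ρ A A' n n b b' i j)
    {B B' : ℤ × ℤ} (hB : StrictNW B' B) :
    (H r A B A' B' : RatFunc ℚ) = shiftedF ρ A A' B B' := by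
  refine H_eq_shiftedF_of fun n n' hn hn' => ?_
  obtain ⟨hx, hy⟩ := hB
  have h' : ∀ n b b' i j, b' < b → pairGF (fun P Q => r ≤ cro A P A' Q) A A' n n b b' i j =
      shiftedGF ρ A A' n n b b' i j := by
    intro n b b' i j hb
    rw [← h n b b' i j hb.le]
    refine pairGF_congr fun P Q _ _ hP hQ => ?_
    rw [eastCro_of_lt (by omega)]
  rcases le_total n' n with hl | hl
  · obtain ⟨l, rfl⟩ := Nat.exists_eq_add_of_le hl
    rw [pairGF_extend_left (fun P Q a hP hQ => by rw [cro_concat_left hA (by omega)]) (A.1 - ρ)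
      (RatFunc.X ^ (ρ * (ρ + A'.1 - A.1)) * gauss false n' (B'.1 - A'.1 - ρ))]
    · rw [shiftedGF, sub_sub_eq_add_sub, add_sub_right_comm]
      ring
    · intro i b₀ h₁ h₂
      rw [h' _ _ _ _ _ (by push_cast at hn; omega), shiftedGF,
        show b₀ - (A.1 - ρ) = b₀ - A.1 + ρ by ring]
      ring
  · obtain ⟨l, rfl⟩ := Nat.exists_eq_add_of_le hl
    rw [pairGF_comm, pairGF_extend_left (fun Q P a hQ hP => by
        rw [cro_comm, cro_concat_left hA.symm (by omega), cro_comm]) (A'.1 + ρ)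
      (RatFunc.X ^ (ρ * (ρ + A'.1 - A.1)) * gauss false n (B.1 - A.1 + ρ))]
    · rw [shiftedGF, sub_sub]
      ring
    · intro i b₀ h₁ h₂
      rw [pairGF_comm, h' _ _ _ _ _ (by omega), shiftedGF, sub_sub]
      ring

/-- For paths with both end points in common. Two different paths have `k + 1` crossings seen from
one side if and only if they have `k + 1` crossings, and seen from the other side if and only if
they have `k` crossings; identical paths are never counted since `1 ≤ k`. -/
theorem H_add_H_succ (A B : ℤ × ℤ) {k : ℕ} (hk : 1 ≤ k) :
    (H k A B A B : RatFunc ℚ) + (H (k + 1) A B A B : RatFunc ℚ) = 2 * f (k + 1) A A B B := by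
  classical
  rw [← shiftedF_natCast]
  by_cases h₀ : B.1 - A.1 + (B.2 - A.2) < 0
  · rw [H_eq_zero k (Or.inl h₀), H_eq_zero (k + 1) (Or.inl h₀), shiftedF_eq_zero (Or.inl h₀),
      mul_zero, ← add_zero (0 : RatFunc ℚ)]
    congr 1 <;> exact map_zero (algebraMap ℚ[X] (RatFunc ℚ))
  · obtain ⟨n, hn⟩ := Int.eq_ofNat_of_zero_le (not_lt.mp h₀)
    rw [H_eq_pairGF k hn hn, H_eq_pairGF (k + 1) hn hn, ← shiftedGF_eq_shiftedF hn hn, two_mul,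
      ← eastGF_self (k + 1) A n _ _ _ _ le_rfl]
    conv_rhs => rw [eastGF]; arg 2; rw [pairGF_comm]
    unfold pairGF
    simp only [← Finset.sum_add_distrib]
    refine Finset.sum_congr rfl fun P hP => Finset.sum_congr rfl fun Q hQ => ?_
    by_cases he : (endPoint A P).1 = B.1 ∧ (endPoint A Q).1 = B.1
    · have hl : P.length = Q.length := (mem_words.mp hP).trans (mem_words.mp hQ).symm
      have h₁ := not_lastWest_and_lastWest (A := A) (A' := A) hl
      simp only [he.1, he.2, true_and, eastCro, cro_comm A A Q P]
      rcases lastWest_or_lastWest_or_eq A A hl with h₂ | h₂ | rfl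
      · have h₃ : ¬ LastWest A Q A P := fun h => h₁ ⟨h₂, h⟩
        simp [h₂, h₃]
      · have h₃ : ¬ LastWest A P A Q := fun h => h₁ ⟨h, h₂⟩
        simp [h₂, h₃, add_comm]
      · have h₃ : ¬ LastWest A P A P := fun h => h₁ ⟨h, h⟩
        have h₄ : ¬ k ≤ 0 := by omega
        simp [h₃, cro_self, h₄]
    · have h₁ : ∀ p : Prop, ¬ ((endPoint A P).1 = B.1 ∧ (endPoint A Q).1 = B.1 ∧ p) :=
        fun p h => he ⟨h.1, h.2.1⟩
      simp only [h₁, if_false]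

theorem exists_H_eq_zero (A B A' B' : ℤ × ℤ) : ∃ R, ∀ r, R ≤ r → H r A B A' B' = 0 := by
  classical
  refine ⟨(Finset.univ.sup fun p : LPath A B × LPath A' B' => cro A p.1.1 A' p.2.1) + 1,
    fun r hr => ?_⟩
  rw [H, pairs, Finset.filter_false_of_mem, Finset.sum_empty]
  intro p _ hp
  have := Finset.le_sup (f := fun p : LPath A B × LPath A' B' => cro A p.1.1 A' p.2.1)
    (Finset.mem_univ p)
  omega

/-- A sequence with finitely many nonzero terms is recovered from its sums of consecutive terms
by an alternating sum. -/
theorem eq_two_mul_finsum {K : Type*} [Field K] [CharZero K] {T φ : ℕ → K}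
    (h : ∀ k, 1 ≤ k → T k + T (k + 1) = 2 * φ (k + 1)) {R : ℕ} (hR : ∀ k, R ≤ k → T k = 0)
    {r : ℕ} (hr : 1 ≤ r) :
    (Function.support fun j => φ (r + j)).Finite ∧
      T r = 2 * ∑ᶠ (j : ℕ) (_ : 1 ≤ j), (-1) ^ (j - 1) * φ (r + j) := by
  have hφ : ∀ j, R + 1 ≤ j → φ (r + j) = 0 := by
    intro j hj
    have := h (r + j - 1) (by omega)
    rw [hR _ (by omega), hR _ (by omega), Nat.sub_add_cancel (by omega)] at this
    simpa using this.symm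
  refine ⟨(Set.finite_Iic R).subset fun j hj => ?_, ?_⟩
  · by_contra hj'
    exact hj (hφ j (by simpa using hj'))
  have tel : ∀ N, T r =
      2 * ∑ j ∈ Finset.Icc 1 N, (-1) ^ (j - 1) * φ (r + j) + (-1) ^ N * T (r + N) := by
    intro N
    induction N with
    | zero => simp
    | succ N ih =>
      rw [ih, Finset.sum_Icc_succ_top (by omega), Nat.add_sub_cancel, mul_add, ← add_assoc r,
        mul_left_comm, ← h (r + N) (by omega), pow_succ]
      ring
  have e : ∑ᶠ (j : ℕ) (_ : 1 ≤ j), (-1) ^ (j - 1) * φ (r + j) =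
      ∑ j ∈ Finset.Icc 1 R, (-1) ^ (j - 1) * φ (r + j) := by
    refine finsum_cond_eq_sum_of_cond_iff _ fun {j} hj => ?_
    rw [Finset.mem_Icc]
    refine ⟨fun h₁ => ⟨h₁, ?_⟩, fun h₁ => h₁.1⟩
    by_contra h₂
    exact hj (by rw [hφ j (by omega), mul_zero])
  rw [e, tel R, hR (r + R) (by omega), mul_zero, add_zero]

/-- At a common end point the crossings seen from the east or from the west are one more than the
crossings; the parity of `r` decides from which side `H r` is read off. -/
theorem H_of_common_end {A A' : ℤ × ℤ} (hA : A.1 + A.2 = A'.1 + A'.2) (hlt : A.1 < A'.1)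
    (B : ℤ × ℤ) (r : ℕ) : (H r A B A' B : RatFunc ℚ) = f r A A' B B := by
  rcases Nat.even_or_odd' r with ⟨m, rfl | rfl⟩
  · rw [← shiftedF_natCast]
    refine H_eq_shiftedF_of fun n n' hn hn' => ?_
    obtain rfl : n = n' := by omega
    rw [← (eastGF_of_lt hA hlt m).1 _ _ _ _ _ le_rfl]
    refine pairGF_congr fun P Q hP hQ _ _ => ?_
    have hl := hP.trans hQ.symm
    obtain ⟨c, hc⟩ := odd_eastCro hA hlt hl
    have := eastCro_eq_or_eq hlt hl
    obtain ⟨d, hd⟩ := even_eastCro hA hlt hl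
    omega
  · rw [H_comm, ← shiftedF_natCast, ← shiftedF_add hA]
    refine H_eq_shiftedF_of fun n n' hn hn' => ?_
    obtain rfl : n = n' := by omega
    rw [← (eastGF_of_lt hA hlt m).2 _ _ _ _ _ le_rfl]
    refine pairGF_congr fun Q P hQ hP _ _ => ?_
    have hl := hP.trans hQ.symm
    rw [cro_comm]
    obtain ⟨c, hc⟩ := odd_eastCro hA hlt hl
    have := eastCro_eq_or_eq hlt hl
    obtain ⟨d, hd⟩ := even_eastCro hA hlt hl
    omega

end NEPath

theorem theorem4 (A₁ A₂ B₁ B₂ : ℤ × ℤ)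
    (hA : NEPath.StrictNW A₁ A₂) (hB : NEPath.StrictNW B₁ B₂)
    (hdiag : A₁.1 + A₁.2 = A₂.1 + A₂.2) :
    (∀ m : ℕ,
      NEPath.H (2 * m + 1) A₁ B₂ A₂ B₁ = NEPath.H (2 * m) A₁ B₂ A₂ B₁ ∧
      (NEPath.H (2 * m) A₁ B₂ A₂ B₁ : RatFunc ℚ) = NEPath.f (2 * m) A₁ A₂ B₂ B₁) ∧
    (∀ m : ℕ, 1 ≤ m →
      NEPath.H (2 * m) A₁ B₁ A₂ B₂ = NEPath.H (2 * m - 1) A₁ B₁ A₂ B₂ ∧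
      (NEPath.H (2 * m - 1) A₁ B₁ A₂ B₂ : RatFunc ℚ) = NEPath.f (2 * m - 1) A₁ A₂ B₂ B₁) ∧
    (∀ (A B : ℤ × ℤ) (r : ℕ),
      (NEPath.H r A B₁ A B₂ : RatFunc ℚ) = NEPath.f r A A B₂ B₁ ∧
      (NEPath.H r A₁ B A₂ B : RatFunc ℚ) = NEPath.f r A₁ A₂ B B ∧
      (r = 0 → (NEPath.H r A B A B : RatFunc ℚ) = NEPath.f 0 A A B B) ∧
      (1 ≤ r →
        (Function.support fun j : ℕ => NEPath.f (r + j) A A B B).Finite ∧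
        (NEPath.H r A B A B : RatFunc ℚ) =
          2 * ∑ᶠ (j : ℕ) (_ : 1 ≤ j), (-1) ^ (j - 1) * NEPath.f (r + j) A A B B)) := by
  have inj := RatFunc.algebraMap_injective ℚ
  refine ⟨fun m => ?_, fun m hm => ?_, fun A B r => ⟨?_, ?_, ?_, fun hr => ?_⟩⟩
  · have east := (NEPath.eastGF_of_lt hdiag hA.1 m).1
    have h₁ := NEPath.H_eq_shiftedF hdiag east hB
    have h₂ := NEPath.H_eq_shiftedF hdiag (r := 2 * m) (fun n b b' i j hb => by
      rw [← east n b b' i j hb]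
      refine NEPath.pairGF_congr fun P Q hP hQ _ _ => ?_
      obtain ⟨c, hc⟩ := NEPath.odd_eastCro hdiag hA.1 (hP.trans hQ.symm)
      omega) hB
    exact ⟨inj (h₁.trans h₂.symm), h₂⟩
  · obtain ⟨m, rfl⟩ := Nat.exists_eq_add_of_le' hm
    have west := (NEPath.eastGF_of_lt hdiag hA.1 m).2
    have h₁ := NEPath.H_eq_shiftedF hdiag.symm west hB
    have h₂ := NEPath.H_eq_shiftedF hdiag.symm (r := 2 * m + 1) (fun n b b' i j hb => by
      rw [← west n b b' i j hb]
      refine NEPath.pairGF_congr fun Q P hQ hP _ _ => ?_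
      obtain ⟨c, hc⟩ := NEPath.even_eastCro hdiag hA.1 (hP.trans hQ.symm)
      omega) hB
    rw [show 2 * (m + 1) = 2 * m + 2 by ring, show 2 * m + 2 - 1 = 2 * m + 1 by omega,
      NEPath.H_comm, NEPath.H_comm (2 * m + 1)]
    refine ⟨inj (h₁.trans h₂.symm), ?_⟩
    rw [h₂, NEPath.shiftedF_add hdiag, NEPath.shiftedF_natCast]
  · rw [NEPath.H_comm]
    exact NEPath.H_eq_shiftedF rfl (NEPath.eastGF_self r A) hB
  · exact NEPath.H_of_common_end hdiag hA.1 B r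
  · rintro rfl
    refine NEPath.H_eq_shiftedF_of (ρ := (0 : ℕ)) fun n n' _ _ => ?_
    rw [Nat.cast_zero, NEPath.shiftedGF_zero]
    exact NEPath.pairGF_of_forall (fun _ _ _ _ => Nat.zero_le _) _ _ _ _
  · obtain ⟨R, hR⟩ := NEPath.exists_H_eq_zero A B A B
    refine NEPath.eq_two_mul_finsum (T := fun r => (NEPath.H r A B A B : RatFunc ℚ))
      (φ := fun r => NEPath.f r A A B B) (fun k hk => NEPath.H_add_H_succ A B hk) (R := R)
      (fun k hk => ?_) hr
    simp only [hR k hk]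
    exact map_zero (algebraMap ℚ[X] (RatFunc ℚ))
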